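/- Call an integer $p\ge 1$ a period of a finite word $w$ if $p\le |w|$ and $w[i]=w[i+p]$ for $1\le i\le |w|-p$. A nonempty word $w$ is a repetition if it has a period $p\le |w|/2$. A repetition factorization of width $t\ge 1$ of a word $w$ is a list $w_1,\dots,w_t$ of repetitions with $w=w_1w_2\cdots w_t$. Let $\mathrm{sw}(w)$ be the smallest width of a repetition factorization of $w$, and $\mathrm{sw}(w)=0$ if $w$ has none. For a finite sequence $u$ over $\{-1,+1\}$ (the unfolding instructions), the paperfolding word ${\bf f}_u$ over $\{-1,+1\}$ is defined by ${\bf f}_\varepsilon=\varepsilon$ and ${\bf f}_{ua}={\bf f}_u\,a\,(-{\bf f}_u)^R$ for $a\in\{-1,+1\}$, where $-w$ is $w$ with every letter negated and $w^R$ is the reversal of $w$. For an infinite sequence $u=u_0u_1u_2\cdots$ over $\{-1,+1\}$, the infinite paperfolding sequence ${\bf f}_u$ is the limit of the words ${\bf f}_{u_0\cdots u_{t-1}}$ as $t\to\infty$, each of which is a prefix of the next. Theorem. Let $u$ be a finite sequence over $\{-1,+1\}$ with $|u|\ge 8$. Then exactly one of the following holds: (a) every factor $x$ of ${\bf f}_u$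 that has a repetition factorization satisfies $\mathrm{sw}(x)\le 7$; (b) there is a factor $x$ of ${\bf f}_u$ with $\mathrm{sw}(x)=10$. Likewise, for every infinite sequence $u$ over $\{-1,+1\}$, exactly one of (a) and (b) holds for the finite factors $x$ of the infinite paperfolding sequence ${\bf f}_u$. -/

import Mathlib

namespace Paperfolding

/-- A nonempty word `w` is a repetition if it has a period `p` with `1 ≤ p ≤ |w| / 2`. -/
def IsRepetition {α : Type*} (w : List α) : Prop :=
  w ≠ [] ∧ ∃ p : ℕ, 1 ≤ p ∧ 2 * p ≤ w.length ∧ w.HasPeriod p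

/-- `ws` is a repetition factorization of `w`: a nonempty list of repetitions whose
concatenation is `w`. Its width is `ws.length`. -/
def IsRepetitionFactorization {α : Type*} (w : List α) (ws : List (List α)) : Prop :=
  ws ≠ [] ∧ (∀ v ∈ ws, IsRepetition v) ∧ ws.flatten = w

/-- The word `w` has at least one repetition factorization. -/
def HasRepetitionFactorization {α : Type*} (w : List α) : Prop :=
  ∃ ws : List (List α), IsRepetitionFactorization w ws

/-- The shortest width of a repetition factorization of `w`; it is `0` if there is none
(the infimum of the empty set of natural numbers is `0`). -/
noncomputable def sw {α : Type*} (w : List α) : ℕ :=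
  sInf {t : ℕ | ∃ ws : List (List α), IsRepetitionFactorization w ws ∧ ws.length = t}

/-- One unfolding with instruction `a`: the word `w` becomes `w a (-w)ᴿ`. The alphabet
`{-1, +1}` is the group `ℤˣ` of units of the integers. -/
def unfold (w : List ℤˣ) (a : ℤˣ) : List ℤˣ :=
  w ++ a :: (w.map (fun b => -b)).reverse

/-- The finite paperfolding word `f_u` coded by the finite sequence `u` of unfolding
instructions: `f_ε = ε` and `f_{ua} = f_u a (-f_u)ᴿ`. -/
def finiteWord (u : List ℤˣ) : List ℤˣ :=
  u.foldl unfold []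

theorem finiteWord_append_singleton (u : List ℤˣ) (a : ℤˣ) :
    finiteWord (u ++ [a]) = unfold (finiteWord u) a := by
  simp [finiteWord]

theorem length_finiteWord (u : List ℤˣ) : (finiteWord u).length + 1 = 2 ^ u.length := by
  induction u using List.reverseRecOn with
  | nil => simp [finiteWord]
  | append_singleton u a ih =>
    rw [finiteWord_append_singleton]
    simp only [unfold, List.length_append, List.length_cons, List.length_reverse,
      List.length_map, List.length_nil, pow_add]
    omega

/-- The first `t` terms `u 0, …, u (t - 1)` of an infinite sequence of instructions. -/
def firstInstructions (u : ℕ → ℤˣ) (t : ℕ) : List ℤˣ :=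
  (List.range t).map u

theorem lt_length_finiteWord (u : ℕ → ℤˣ) (n : ℕ) :
    n < (finiteWord (firstInstructions u (n + 1))).length := by
  have h := length_finiteWord (firstInstructions u (n + 1))
  have h2 : n + 1 < 2 ^ (n + 1) := Nat.lt_two_pow_self
  simp only [firstInstructions, List.length_map, List.length_range] at h ⊢
  omega

/-- The infinite paperfolding sequence coded by `u`: the limit of the finite words
`f_{u 0 ⋯ u (t-1)}`, each of which is a prefix of the next. Here `infiniteWord u n` is the
letter with index `n` when the indices start at `0`. -/
def infiniteWord (u : ℕ → ℤˣ) (n : ℕ) : ℤˣ :=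
  (finiteWord (firstInstructions u (n + 1)))[n]'(lt_length_finiteWord u n)

/-- `x` is a finite factor (a block of consecutive letters) of the infinite word `f`. -/
def IsFactorOfSeq {α : Type*} (x : List α) (f : ℕ → α) : Prop :=
  ∃ i n : ℕ, x = (List.range n).map (fun j => f (i + j))

end Paperfolding

/-!
A paperfolding sequence `f`, indexed from `1`, is given by the Toeplitz formula
`f (2 ^ k * (2 * j + 1)) = u k * (-1) ^ j` (`getElem?_finiteWord`, `isToeplitz_letter`). Two
consequences make the theorem a finite one.

* Repetitions are short (`IsToeplitz.repAt_iff`). A letter at an odd index is the negative of the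
  letter two places later, and `n ↦ f (2 * n)` is again a paperfolding sequence; so a square of
  even order would descend to one of order `≡ 2 (mod 4)`, which is impossible. If the period `p`
  is odd, `f m = f (m + p)` pairs odd indices with even ones, so the alternation at odd indices is
  copied to even ones, where four consecutive letters cannot alternate; hence
  `f m = f (m + p)` holds for at most six consecutive `m`. A repetition therefore has period
  `1`, `3` or `5` and length at most `11`.
* Windows are finite words (`block_eq_finiteWord`). The `127` letters around a multiple `64 c` of
  `64` form the word `f_v` with `v = (u 0, …, u 4, ± u 5, f (64 c))`, so there are finitely many.

If `u 0 ≠ u 1 = u 2`, a search of these windows shows that the lengths of the factorable factors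
with a given starting point that are reached by at most seven repetitions are at most `52` and
closed under appending a further repetition; so every factorable factor has width at most `7`
(`sw_block_le_seven`). In all other cases the instructions `u 0, …, u 4` determine a sign `b` such
that the window with sixth instruction `b` has a factor of width exactly `10`, whatever its
seventh instruction is; the windows around `64` and around `128` have opposite sixth
instructions, so one of them will do, and both lie in the first `255` letters
(`exists_sw_block_eq_ten`). A factor of width `10` contradicts the bound `7`, so the two cases
exclude each other.

The search is done by evaluation in the kernel, on windows stored as the binary digits of natural
numbers.
-/

namespace Paperfolding

/-! ### Toeplitz sequences and the orders of their squares -/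

/-- The Toeplitz formula for the paperfolding sequence `g` with instructions `u`. Indices start at
`1`: every positive index is uniquely `2 ^ k * (2 * j + 1)`, and `g 0` is left arbitrary. -/
def IsToeplitz (u g : ℕ → ℤˣ) : Prop :=
  ∀ k j, g (2 ^ k * (2 * j + 1)) = u k * (-1) ^ j

theorem units_ne_neg (a : ℤˣ) : a ≠ -a := by
  rcases Int.units_eq_one_or a with rfl | rfl <;> decide

namespace IsToeplitz

variable {u g : ℕ → ℤˣ}

theorem comp_two_mul (h : IsToeplitz u g) :
    IsToeplitz (fun k => u (k + 1)) (fun n => g (2 * n)) := by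
  intro k j
  rw [← h (k + 1) j, pow_succ', mul_assoc]

theorem add_two_mul_of_odd (h : IsToeplitz u g) {n : ℕ} (hn : n % 2 = 1) (i : ℕ) :
    g (n + 2 * i) = g n * (-1) ^ i := by
  obtain ⟨j, rfl⟩ : ∃ j, n = 2 * j + 1 := ⟨n / 2, by omega⟩
  have h1 := h 0 j
  have h2 := h 0 (j + i)
  rw [pow_zero, one_mul] at h1 h2
  rw [h1, show 2 * j + 1 + 2 * i = 2 * (j + i) + 1 by ring, h2, pow_add, mul_assoc]

theorem add_four_of_mod_four (h : IsToeplitz u g) {n : ℕ} (hn : n % 4 = 2) :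
    g (n + 4) = -g n := by
  have h1 := h.comp_two_mul.add_two_mul_of_odd (n := n / 2) (by omega) 1
  simp only [pow_one, mul_neg, mul_one] at h1
  rwa [show 2 * (n / 2 + 2) = n + 4 by omega, show 2 * (n / 2) = n by omega] at h1

/-- A Toeplitz sequence has no square of even order: passing to `n ↦ g (2 * n)` halves the order,
and at an order `p ≡ 2 (mod 4)` the letter `p` places after an odd index is the negative one. -/
theorem not_square_of_even {p : ℕ} (hp : 0 < p) (hpe : p % 2 = 0) :
    ∀ {u g : ℕ → ℤˣ} {s : ℕ}, IsToeplitz u g →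
      ¬ ∀ m, s ≤ m → m < s + p → g m = g (m + p) := by
  induction p using Nat.strong_induction_on with
  | _ p ih =>
    intro u g s h hs
    obtain ⟨r, rfl⟩ : ∃ r, p = 2 * r := ⟨p / 2, by omega⟩
    rcases Nat.mod_two_eq_zero_or_one r with hr | hr
    · refine ih r (by omega) (by omega) hr (s := (s + 1) / 2) h.comp_two_mul ?_
      intro m h1 h2
      have := hs (2 * m) (by omega) (by omega)
      rwa [← mul_add] at this
    · have key : ∀ m, m % 2 = 1 → g m ≠ g (m + 2 * r) := by
        intro m hm
        rw [h.add_two_mul_of_odd hm, Odd.neg_one_pow (Nat.odd_iff.2 hr), mul_neg, mul_one]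
        exact units_ne_neg _
      rcases Nat.mod_two_eq_zero_or_one s with h0 | h1
      · exact key (s + 1) (by omega) (hs _ (by omega) (by omega))
      · exact key s h1 (hs _ le_rfl (by omega))

/-- The letters at `e, e + 2, e + 4, e + 6` with `e` even do not alternate with period `4`, since
`e` or `e + 2` is `2` modulo `4`. -/
theorem not_alternating_of_even (h : IsToeplitz u g) {e : ℕ} (he : e % 2 = 0)
    (h1 : g e = g (e + 4)) (h2 : g (e + 2) = g (e + 6)) : False := by
  rcases (by omega : e % 4 = 2 ∨ (e + 2) % 4 = 2) with h4 | h4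
  · exact units_ne_neg _ (h1.trans (h.add_four_of_mod_four h4))
  · exact units_ne_neg _ (h2.trans (h.add_four_of_mod_four h4))

/-- For odd `p`, the sequence agrees with its shift by `p` on at most six consecutive indices:
seven of them contain four indices `m` that give four consecutive even indices `m` or `m + p`,
paired with odd ones, where the letters have period `4`. -/
theorem agreement_le_of_odd (h : IsToeplitz u g) {p q s : ℕ} (hp : p % 2 = 1)
    (hs : ∀ m, s ≤ m → m < s + q → g m = g (m + p)) : q ≤ 6 := by
  by_contra hq
  have h4 : ∀ n, n % 2 = 1 → g n = g (n + 4) := by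
    intro n hn
    have := h.add_two_mul_of_odd hn 2
    simpa using this.symm
  rcases Nat.mod_two_eq_zero_or_one s with h0 | h1
  · refine h.not_alternating_of_even h0 ?_ ?_
    · rw [hs s le_rfl (by omega), hs (s + 4) (by omega) (by omega), h4 (s + p) (by omega)]
      congr 1; ring
    · rw [hs (s + 2) (by omega) (by omega), hs (s + 6) (by omega) (by omega),
        h4 (s + 2 + p) (by omega)]
      congr 1; ring
  · refine h.not_alternating_of_even (e := s + p) (by omega) ?_ ?_
    · rw [← hs s le_rfl (by omega), show s + p + 4 = s + 4 + p by ring,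
        ← hs (s + 4) (by omega) (by omega), h4 s h1]
    · rw [show s + p + 2 = s + 2 + p by ring, show s + p + 6 = s + 6 + p by ring,
        ← hs (s + 2) (by omega) (by omega), ← hs (s + 6) (by omega) (by omega),
        h4 (s + 2) (by omega)]

end IsToeplitz

/-- The block of length `n` of `g` that starts at index `s` is a repetition, expressed on indices
(see `isRepetition_block`). -/
def RepAt (g : ℕ → ℤˣ) (s n : ℕ) : Prop :=
  ∃ p, 1 ≤ p ∧ 2 * p ≤ n ∧ ∀ j, j + p < n → g (s + j) = g (s + j + p)

/-- A repetition in a Toeplitz sequence has period `p ∈ {1, 3, 5}` and length `p + q` with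
`p ≤ q ≤ 6`. -/
theorem IsToeplitz.repAt_iff {u g : ℕ → ℤˣ} (h : IsToeplitz u g) {s n : ℕ} :
    RepAt g s n ↔ ∃ p q, (p = 1 ∨ p = 3 ∨ p = 5) ∧ p ≤ q ∧ q ≤ 6 ∧ n = p + q ∧
      ∀ j < q, g (s + j) = g (s + j + p) := by
  constructor
  · rintro ⟨p, hp, hpn, hs⟩
    have hm : ∀ m, s ≤ m → m < s + (n - p) → g m = g (m + p) := by
      intro m h1 h2
      have := hs (m - s) (by omega)
      rwa [Nat.add_sub_cancel' h1] at this
    have hodd : p % 2 = 1 := by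
      by_contra hpe
      exact IsToeplitz.not_square_of_even hp (by omega) h
        fun m h1 h2 => hm m h1 (by omega)
    have := h.agreement_le_of_odd hodd hm
    exact ⟨p, n - p, by omega, by omega, this, by omega, fun j hj => hs j (by omega)⟩
  · rintro ⟨p, q, hp, hpq, -, rfl, hs⟩
    exact ⟨p, by omega, by omega, fun j hj => hs j (by omega)⟩

/-! ### Blocks and chains of repetitions -/

/-- The word of the `n` letters of `g` with indices `s, …, s + n - 1`. -/
def block (g : ℕ → ℤˣ) (s n : ℕ) : List ℤˣ :=
  (List.range n).map fun j => g (s + j)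

@[simp] theorem length_block (g : ℕ → ℤˣ) (s n : ℕ) : (block g s n).length = n := by
  simp [block]

theorem getElem?_block (g : ℕ → ℤˣ) (s n j : ℕ) :
    (block g s n)[j]? = if j < n then some (g (s + j)) else none := by
  by_cases h : j < n <;> simp [block, h]

theorem block_add (g : ℕ → ℤˣ) (s m n : ℕ) :
    block g s (m + n) = block g s m ++ block g (s + m) n := by
  simp [block, List.range_add, add_assoc, Function.comp_def]

theorem isRepetition_block {g : ℕ → ℤˣ} {s n : ℕ} :
    IsRepetition (block g s n) ↔ RepAt g s n := by
  have key : ∀ p, (block g s n).HasPeriod p ↔ ∀ j, j + p < n → g (s + j) = g (s + j + p) := by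
    intro p
    rw [List.hasPeriod_iff_getElem?, length_block]
    constructor
    · intro h j hj
      have := h j (by omega)
      rw [getElem?_block, getElem?_block, if_pos (by omega), if_pos hj] at this
      simpa [add_assoc] using this
    · intro h j hj
      rw [getElem?_block, getElem?_block, if_pos (by omega), if_pos (by omega),
        h j (by omega), add_assoc]
  constructor
  · rintro ⟨-, p, hp, hn, h⟩
    exact ⟨p, hp, by simpa using hn, (key p).1 h⟩
  · rintro ⟨p, hp, hn, h⟩
    refine ⟨?_, p, hp, by simpa using hn, (key p).2 h⟩
    intro h0
    have := congrArg List.length h0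
    simp at this
    omega

/-- The block of length `n` of `g` that starts at index `s` is a concatenation of exactly `t`
repetitions; for `t = 0` this means `n = 0`. -/
def Reach (g : ℕ → ℤˣ) (s : ℕ) : ℕ → ℕ → Prop
  | 0, n => n = 0
  | t + 1, n => ∃ m r, Reach g s t m ∧ RepAt g (s + m) r ∧ n = m + r

theorem reach_iff {g : ℕ → ℤˣ} {s t n : ℕ} :
    Reach g s t n ↔ ∃ ws : List (List ℤˣ), ws.length = t ∧ (∀ v ∈ ws, IsRepetition v) ∧
      ws.flatten = block g s n := by
  induction t generalizing n with
  | zero =>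
    constructor
    · rintro rfl
      exact ⟨[], by simp [block]⟩
    · rintro ⟨ws, h, -, hw⟩
      obtain rfl := List.length_eq_zero_iff.1 h
      simpa [Reach] using (congrArg List.length hw).symm
  | succ t ih =>
    constructor
    · rintro ⟨m, r, hm, hr, rfl⟩
      obtain ⟨ws, hl, hws, hf⟩ := ih.1 hm
      refine ⟨ws ++ [block g (s + m) r], by simp [hl], ?_, by simp [hf, block_add]⟩
      intro v hv
      rcases List.mem_append.1 hv with hv | hv
      · exact hws v hv
      · rw [List.mem_singleton.1 hv]
        exact isRepetition_block.2 hr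
    · rintro ⟨ws, hl, hws, hf⟩
      rcases List.eq_nil_or_concat ws with rfl | ⟨ws', v, rfl⟩
      · simp at hl
      · simp only [List.concat_eq_append, List.flatten_append, List.flatten_cons,
          List.flatten_nil, List.append_nil] at hf hws hl
        obtain ⟨r, rfl⟩ : ∃ r, n = ws'.flatten.length + r := by
          have := congrArg List.length hf
          rw [List.length_append, length_block] at this
          exact ⟨_, this.symm⟩
        rw [block_add] at hf
        obtain ⟨h1, h2⟩ := List.append_inj hf (by simp)
        refine ⟨_, r, ih.2 ⟨ws', by simpa using hl, fun w hw => hws w (by simp [hw]), h1⟩,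
          ?_, rfl⟩
        rw [← isRepetition_block, ← h2]
        exact hws v (by simp)

theorem isRepetitionFactorization_block {g : ℕ → ℤˣ} {s n t : ℕ} :
    (∃ ws, IsRepetitionFactorization (block g s n) ws ∧ ws.length = t) ↔
      t ≠ 0 ∧ Reach g s t n := by
  rw [reach_iff]
  constructor
  · rintro ⟨ws, ⟨h0, h1, h2⟩, rfl⟩
    exact ⟨by simpa using h0, ws, rfl, h1, h2⟩
  · rintro ⟨h0, ws, rfl, h1, h2⟩
    exact ⟨ws, ⟨by simpa using h0, h1, h2⟩, rfl⟩

theorem hasRepetitionFactorization_of_sw_ne_zero {w : List ℤˣ} (h : sw w ≠ 0) :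
    HasRepetitionFactorization w := by
  obtain ⟨t, ws, hws, -⟩ := Nat.nonempty_of_sInf_eq_succ (Nat.succ_pred_eq_of_ne_zero h).symm
  exact ⟨ws, hws⟩

/-! ### The Toeplitz formula for paperfolding words -/

/-- The Toeplitz formula for finite paperfolding words, where the letter with index `N` counted
from `1` is the list entry `N - 1`. An index beyond the middle of `f_{ua}` is reflected to
`2 ^ (|u| + 1) - N`, which has the same `k` and a `j` of opposite parity. -/
theorem getElem?_finiteWord (u : List ℤˣ) (k j : ℕ) (h : 2 ^ k * (2 * j + 1) < 2 ^ u.length) :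
    (finiteWord u)[2 ^ k * (2 * j + 1) - 1]? = some (u.getD k 1 * (-1) ^ j) := by
  induction u using List.reverseRecOn generalizing j with
  | nil => 
    have : 0 < 2 ^ k * (2 * j + 1) := by positivity
    simp at h
  | append_singleton u a ih =>
    have hlen := length_finiteWord u
    rw [finiteWord_append_singleton, unfold]
    have hk0 : 0 < 2 ^ k := by positivity
    have hkN : 2 ^ k ≤ 2 ^ k * (2 * j + 1) := Nat.le_mul_of_pos_right _ (by omega)
    rw [List.length_append, List.length_singleton] at h
    set N := 2 ^ k * (2 * j + 1) with hN
    have hk : k ≤ u.length :=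
      Nat.lt_succ_iff.1 ((Nat.pow_lt_pow_iff_right (by norm_num)).1 (hkN.trans_lt h))
    rcases lt_trichotomy N (2 ^ u.length) with hlt | heq | hgt
    · have hk' : k < u.length :=
        (Nat.pow_lt_pow_iff_right (by norm_num)).1 (hkN.trans_lt hlt)
      rw [List.getElem?_append_left (by omega), ih j hlt, List.getD_append _ _ _ _ hk']
    · -- The middle letter: `2 ^ k * (2 * j + 1) = 2 ^ |u|` forces `k = |u|` and `j = 0`.
      obtain ⟨d, hd⟩ := Nat.exists_eq_add_of_le hk
      have heq' := heq
      rw [hN, hd, pow_add] at heq'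
      have hodd := Nat.eq_of_mul_eq_mul_left hk0 heq'
      obtain rfl : d = 0 := by
        by_contra hd0
        obtain ⟨d', rfl⟩ := Nat.exists_eq_succ_of_ne_zero hd0
        rw [pow_succ] at hodd
        omega
      obtain rfl : j = 0 := by simpa using hodd
      rw [add_zero] at hd
      subst hd
      rw [List.getElem?_append_right (by omega),
        show N - 1 - (finiteWord u).length = 0 by omega]
      simp
    · have hk' : k < u.length := by
        refine lt_of_le_of_ne hk ?_
        rintro rfl
        rw [pow_succ] at h
        have h1 : 2 * j + 1 < 2 := lt_of_mul_lt_mul_left h (Nat.zero_le _)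
        rw [hN, show 2 * j + 1 = 1 by omega] at hgt
        omega
      obtain ⟨d, hd⟩ := Nat.exists_eq_add_of_lt hk'
      have hpow : 2 ^ (u.length + 1) = 2 ^ k * (2 * (2 * 2 ^ d)) := by
        rw [hd]; ring
      have hlt : 2 * j + 1 < 2 * (2 * 2 ^ d) := by
        rw [hpow] at h
        exact lt_of_mul_lt_mul_left h (Nat.zero_le _)
      -- The index reflected in the middle is `2 ^ k * (2 * i + 1)`.
      obtain ⟨i, hi⟩ : ∃ i, j + i + 1 = 2 * 2 ^ d := ⟨2 * 2 ^ d - j - 1, by omega⟩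
      have hsum : N + 2 ^ k * (2 * i + 1) = 2 ^ (u.length + 1) := by
        rw [hpow, hN, ← hi]; ring
      have h2 : 2 ^ (u.length + 1) = 2 * 2 ^ u.length := by ring
      rw [h2] at hsum h
      have hpos : 0 < 2 ^ k * (2 * i + 1) := by positivity
      have hsign : (-1 : ℤˣ) ^ i = -(-1) ^ j := by
        have : (-1 : ℤˣ) ^ (j + i) = -1 := Odd.neg_one_pow ⟨2 ^ d - 1, by omega⟩
        rw [pow_add] at this
        rcases neg_one_pow_eq_or ℤˣ i with h | h <;> rw [h] at this ⊢ <;> simp_all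
      rw [List.getElem?_append_right (by omega),
        show N - 1 - (finiteWord u).length = N - 2 ^ u.length - 1 + 1 by omega,
        List.getElem?_cons_succ, List.getElem?_reverse (by simp; omega), List.length_map,
        show (finiteWord u).length - 1 - (N - 2 ^ u.length - 1) = 2 ^ k * (2 * i + 1) - 1 by omega,
        List.getElem?_map, ih i (by omega), List.getD_append _ _ _ _ hk', hsign]
      simp

theorem exists_eq_two_pow_mul (N : ℕ) (h : 0 < N) : ∃ k j, N = 2 ^ k * (2 * j + 1) := by
  obtain ⟨k, m, ⟨j, rfl⟩, h⟩ := Nat.exists_eq_two_pow_mul_odd h.ne'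
  exact ⟨k, j, h⟩

theorem getD_firstInstructions (u : ℕ → ℤˣ) {t k : ℕ} (h : k < t) :
    (firstInstructions u t).getD k 1 = u k := by
  simp [firstInstructions, h]

@[simp] theorem length_firstInstructions (u : ℕ → ℤˣ) (t : ℕ) :
    (firstInstructions u t).length = t := by
  simp [firstInstructions]

theorem firstInstructions_getD (u : List ℤˣ) :
    firstInstructions (fun k => u.getD k 1) u.length = u := by
  apply List.ext_getElem
  · simp
  · intro i h1 h2
    simp [firstInstructions, h2]

/-- The letters of the infinite paperfolding sequence, with indices that start at `1`. The junk
value `letter u 0 = letter u 1` plays no role. -/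
noncomputable def letter (u : ℕ → ℤˣ) (N : ℕ) : ℤˣ := infiniteWord u (N - 1)

theorem isToeplitz_letter (u : ℕ → ℤˣ) : IsToeplitz u (letter u) := by
  intro k j
  have hpos : 0 < 2 ^ k * (2 * j + 1) := by positivity
  have hk : k < 2 ^ k := Nat.lt_two_pow_self
  have hkN : 2 ^ k ≤ 2 ^ k * (2 * j + 1) := Nat.le_mul_of_pos_right _ (by omega)
  unfold letter infiniteWord
  rw [← Option.some_inj, ← List.getElem?_eq_getElem, getElem?_finiteWord,
    getD_firstInstructions _ (by omega)]
  rw [length_firstInstructions, Nat.sub_add_cancel hpos]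
  exact Nat.lt_two_pow_self

theorem finiteWord_firstInstructions {u g : ℕ → ℤˣ} (h : IsToeplitz u g) (t : ℕ) :
    finiteWord (firstInstructions u t) = block g 1 (2 ^ t - 1) := by
  have hlen := length_finiteWord (firstInstructions u t)
  rw [length_firstInstructions] at hlen
  apply List.ext_getElem?
  intro d
  rw [getElem?_block]
  split_ifs with hd
  · obtain ⟨k, j, hkj⟩ := exists_eq_two_pow_mul (1 + d) (by omega)
    have hk : k < t := by
      have hkN : 2 ^ k ≤ 2 ^ k * (2 * j + 1) := Nat.le_mul_of_pos_right _ (by omega)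
      exact (Nat.pow_lt_pow_iff_right (a := 2) (by norm_num)).1 (by omega)
    have := getElem?_finiteWord (firstInstructions u t) k j
      (by rw [length_firstInstructions]; omega)
    rw [← hkj, getD_firstInstructions _ hk] at this
    rw [hkj, h, ← this]
    congr 1
    omega
  · exact List.getElem?_eq_none (by omega)

theorem isInfix_block {g : ℕ → ℤˣ} {s M : ℕ} {x : List ℤˣ} :
    x <:+: block g s M ↔ ∃ i n, i + n ≤ M ∧ x = block g (s + i) n := by
  constructor
  · rintro ⟨l, r, h⟩
    have hl := congrArg List.length h
    simp only [List.length_append, length_block] at hl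
    refine ⟨l.length, x.length, by omega, ?_⟩
    rw [← hl, block_add, block_add] at h
    exact (List.append_inj (List.append_inj h (by simp)).1 (by simp)).2
  · rintro ⟨i, n, h, rfl⟩
    obtain ⟨d, rfl⟩ := Nat.exists_eq_add_of_le h
    exact ⟨_, _, by rw [block_add, block_add]⟩

theorem isFactorOfSeq_infiniteWord {u : ℕ → ℤˣ} {x : List ℤˣ} :
    IsFactorOfSeq x (infiniteWord u) ↔ ∃ i n, x = block (letter u) (1 + i) n := by
  have : ∀ i n, block (letter u) (1 + i) n = (List.range n).map fun j => infiniteWord u (i + j) := by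
    intro i n
    refine List.map_congr_left fun j _ => ?_
    rw [letter]
    congr 1
    omega
  simp only [IsFactorOfSeq, this]

/-! ### A search for factorizations by evaluation -/

/-- The paperfolding word of `finiteWord`, over the alphabet `Bool` with `true` for `1` and `false`
for `-1`. -/
def boolWord (l : List Bool) : List Bool :=
  l.foldl (fun w a => w ++ a :: (w.map (fun b => !b)).reverse) []

/-- The natural number whose binary digits, from the least significant one on, are the entries of
the list. The kernel evaluates bit operations on it in one step each. -/
def toCode : List Bool → ℕ
  | [] => 0
  | b :: l => 2 * toCode l + b.toNat

/-- The letters coded by `W` at the `q` positions from `a` on equal those `p` places later (see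
`hasAgreement_iff`). The functions on `ℕ` are named rather than written as notation, so that the
kernel need not unfold the instances behind the notation at every evaluation. -/
def hasAgreement (W p q a : ℕ) : Bool :=
  Nat.beq (Nat.mod (Nat.shiftRight (Nat.xor W (Nat.shiftRight W p)) a) (Nat.pow 2 q)) 0

/-- The numbers `n, n + 1, …`, at most `k` of them, as long as the word coded by `W` agrees from
position `a` on with its shift by `p` for `q, q + 1, …` letters. -/
def endsOfPeriod (W p a : ℕ) : ℕ → ℕ → ℕ → List ℕ
  | 0, _, _ => []
  | k + 1, q, n => bif hasAgreement W p q a then n :: endsOfPeriod W p a k (q + 1) (n + 1) else []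

/-- The lengths `m + r` of the blocks from position `a` on that extend the block of length `m` by a
repetition of length `r`. A repetition of period `p` has length `p + q` with
`p ≤ q ≤ 6`; this gives the start `m + 2 * p` and the bound `7 - p` on the number of lengths. -/
def ends (W a m : ℕ) : List ℕ :=
  endsOfPeriod W 1 (a + m) 6 1 (m + 2) ++
    (endsOfPeriod W 3 (a + m) 4 3 (m + 6) ++ endsOfPeriod W 5 (a + m) 2 5 (m + 10))

/-- If `F` lists the lengths of the concatenations of `t` repetitions from position `a` on, the
result does so for `t + 1`. -/
def nextLayer (W a : ℕ) (F : List ℕ) : List ℕ :=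
  F.flatMap fun m => ends W a m

/-- Starting with the layer `F`, and with `S` collecting the earlier layers, at most `k` further
layers consist of lengths up to `52` before a layer brings nothing new. The bound `52` leaves room
for a repetition of length `11` within the `64` letters that follow any of the first `64` positions
of a window. -/
def saturates (W a : ℕ) : ℕ → List ℕ → List ℕ → Bool
  | 0, S, F => F.all fun n => S.elem n
  | k + 1, S, F => F.all (fun n => S.elem n) ||
      F.all (fun n => Nat.ble n 52) && saturates W a k (F ++ S) (nextLayer W a F)

/-- Starting with the layer `F`, the length `n` occurs in the `k`-th next layer and in none before
it. The test for emptiness ends a hopeless search early. -/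
def firstHits (W a n : ℕ) : ℕ → List ℕ → Bool
  | 0, F => F.elem n
  | k + 1, F => !F.isEmpty && !F.elem n && firstHits W a n k (nextLayer W a F)

/-- In the windows with `u 0 ≠ u 1 = u 2`, seven layers exhaust all factorable blocks that start at
one of the first `64` positions. -/
theorem saturates_boolWord : ∀ a c d e f : Bool,
    ((List.range 64).all fun i =>
      saturates (toCode (boolWord [a, !a, !a, c, d, e, f])) i 8 [] [0]) = true := by
  decide +kernel

/-- In all other cases the first five instructions determine a sixth one `f` such that the window
has a factor of width `10`. The listed positions and lengths are those at which such
factors are found. -/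
theorem firstHits_boolWord : ∀ a b c d e : Bool, (a = b ∨ b ≠ c) → ∃ f, ∀ g,
    ([7, 13, 15, 23, 29, 31, 39, 45, 47, 55, 61, 63].any fun i => [37, 41].any fun n =>
      firstHits (toCode (boolWord [a, b, c, d, e, f, g])) i n 10 [0]) = true := by
  decide +kernel

/-! ### Correctness of the search -/

/-- The letter of `{-1, +1}` encoded by a Boolean. -/
def sgn (b : Bool) : ℤˣ := if b then 1 else -1

theorem sgn_not (b : Bool) : sgn (!b) = -sgn b := by cases b <;> simp [sgn]

theorem sgn_injective : Function.Injective sgn := by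
  intro a b
  cases a <;> cases b <;> simp [sgn]

theorem exists_sgn_eq (a : ℤˣ) : ∃ b, sgn b = a := by
  rcases Int.units_eq_one_or a with rfl | rfl
  · exact ⟨true, rfl⟩
  · exact ⟨false, rfl⟩

theorem map_sgn_boolWord (l : List Bool) : (boolWord l).map sgn = finiteWord (l.map sgn) := by
  induction l using List.reverseRecOn with
  | nil => rfl
  | append_singleton l a ih =>
    rw [List.map_append, List.map_singleton, finiteWord_append_singleton, unfold, ← ih]
    simp [boolWord, List.foldl_append, Function.comp_def, sgn_not]

theorem testBit_toCode (l : List Bool) (d : ℕ) : (toCode l).testBit d = l.getD d false := by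
  induction l generalizing d with
  | nil => simp [toCode]
  | cons b l ih =>
    have : toCode (b :: l) = Nat.bit b (toCode l) := by
      cases b <;> simp [toCode, Nat.bit]
    rw [this]
    cases d with
    | zero => simp
    | succ d => rw [Nat.testBit_bit_succ, ih, List.getD_cons_succ]

/-- The first `L` binary digits of `W` encode the letters of `g` with indices
`s, …, s + L - 1`. -/
def Codes (W : ℕ) (g : ℕ → ℤˣ) (s L : ℕ) : Prop :=
  ∀ d < L, g (s + d) = sgn (W.testBit d)

theorem hasAgreement_iff {W p q a : ℕ} :
    hasAgreement W p q a = true ↔ ∀ j < q, W.testBit (a + j) = W.testBit (a + j + p) := by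
  have : hasAgreement W p q a = true ↔ ((W ^^^ (W >>> p)) >>> a) % 2 ^ q = 0 :=
    Nat.beq_eq ▸ Iff.rfl
  rw [this]
  constructor
  · intro h j hj
    have := congrArg (fun n => n.testBit j) h
    simpa [Nat.testBit_mod_two_pow, hj, Nat.testBit_shiftRight, add_comm p] using this
  · intro h
    apply Nat.eq_of_testBit_eq
    intro j
    by_cases hj : j < q
    · simp [Nat.testBit_mod_two_pow, hj, Nat.testBit_shiftRight, add_comm p, h j hj]
    · simp [Nat.testBit_mod_two_pow, hj]

theorem hasAgreement_mono {W p q q' a : ℕ} (hq : q ≤ q') (h : hasAgreement W p q' a = true) :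
    hasAgreement W p q a = true :=
  hasAgreement_iff.2 fun j hj => hasAgreement_iff.1 h j (hj.trans_le hq)

theorem mem_endsOfPeriod {W p a k q n x : ℕ} :
    x ∈ endsOfPeriod W p a k q n ↔ ∃ j < k, x = n + j ∧ hasAgreement W p (q + j) a = true := by
  induction k generalizing q n with
  | zero => simp [endsOfPeriod]
  | succ k ih =>
    rw [endsOfPeriod]
    constructor
    · intro hx
      cases hq : hasAgreement W p q a
      · simp [hq] at hx
      · rw [hq, cond_true, List.mem_cons, ih] at hx
        rcases hx with rfl | ⟨j, hj, rfl, h⟩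
        · exact ⟨0, by omega, rfl, hq⟩
        · exact ⟨j + 1, by omega, by omega, by rwa [show q + (j + 1) = q + 1 + j by omega]⟩
    · rintro ⟨j, hj, rfl, h⟩
      rw [hasAgreement_mono (Nat.le_add_right q j) h, cond_true, List.mem_cons, ih]
      cases j with
      | zero => exact Or.inl rfl
      | succ j =>
        exact Or.inr ⟨j, by omega, by omega, by rwa [show q + 1 + j = q + (j + 1) by omega]⟩

variable {u g : ℕ → ℤˣ} {W s L : ℕ}

theorem mem_ends (h : IsToeplitz u g) (hW : Codes W g s L) {a m n : ℕ} (hn : a + n ≤ L) :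
    n ∈ ends W a m ↔ ∃ r, RepAt g (s + a + m) r ∧ n = m + r := by
  have key : ∀ p q, n = m + (p + q) → (hasAgreement W p q (a + m) = true ↔
      ∀ j < q, g (s + a + m + j) = g (s + a + m + j + p)) := by
    intro p q hr
    rw [hasAgreement_iff]
    refine forall₂_congr fun j hj => ?_
    rw [show s + a + m + j + p = s + (a + m + j + p) by omega,
      show s + a + m + j = s + (a + m + j) by omega, hW _ (by omega), hW _ (by omega),
      sgn_injective.eq_iff]
  simp only [ends, List.mem_append, mem_endsOfPeriod, h.repAt_iff]
  constructor
  · rintro (⟨j, hj, rfl, hA⟩ | ⟨j, hj, rfl, hA⟩ | ⟨j, hj, rfl, hA⟩)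
    · exact ⟨_, ⟨1, 1 + j, by omega, by omega, by omega, rfl,
        (key _ _ (by omega)).1 hA⟩, by omega⟩
    · exact ⟨_, ⟨3, 3 + j, by omega, by omega, by omega, rfl,
        (key _ _ (by omega)).1 hA⟩, by omega⟩
    · exact ⟨_, ⟨5, 5 + j, by omega, by omega, by omega, rfl,
        (key _ _ (by omega)).1 hA⟩, by omega⟩
  · rintro ⟨r, ⟨p, q, hp, hpq, hq, rfl, hA⟩, hr⟩
    obtain ⟨j, rfl⟩ := Nat.exists_eq_add_of_le hpq
    have hA' := (key _ _ hr).2 hA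
    rcases hp with rfl | rfl | rfl
    · exact Or.inl ⟨j, by omega, by omega, hA'⟩
    · exact Or.inr (Or.inl ⟨j, by omega, by omega, hA'⟩)
    · exact Or.inr (Or.inr ⟨j, by omega, by omega, hA'⟩)

/-- `F` contains exactly the lengths of the concatenations of `t` repetitions that start at position
`a` of the window of length `L` at `s`, as far as these stay inside the window. -/
def IsLayer (g : ℕ → ℤˣ) (s L a t : ℕ) (F : List ℕ) : Prop :=
  ∀ n, a + n ≤ L → (n ∈ F ↔ Reach g (s + a) t n)

theorem isLayer_zero (g : ℕ → ℤˣ) (s L a : ℕ) : IsLayer g s L a 0 [0] := by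
  intro n _
  simp [Reach]

theorem IsLayer.nextLayer (h : IsToeplitz u g) (hW : Codes W g s L) {a t : ℕ} {F : List ℕ}
    (hF : IsLayer g s L a t F) : IsLayer g s L a (t + 1) (nextLayer W a F) := by
  intro n hn
  simp only [Paperfolding.nextLayer, List.mem_flatMap, mem_ends h hW hn, Reach]
  constructor
  · rintro ⟨m, hm, r, hr, rfl⟩
    exact ⟨m, r, (hF m (by omega)).1 hm, hr, rfl⟩
  · rintro ⟨m, r, hm, hr, rfl⟩
    exact ⟨m, (hF m (by omega)).2 hm, r, hr, rfl⟩

theorem reach_of_firstHits (h : IsToeplitz u g) (hW : Codes W g s L) {a n k t : ℕ} {F : List ℕ}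
    (hn : a + n ≤ L) (hF : IsLayer g s L a t F) (hk : firstHits W a n k F = true) :
    Reach g (s + a) (t + k) n ∧ ∀ j < k, ¬ Reach g (s + a) (t + j) n := by
  induction k generalizing t F with
  | zero =>
    rw [firstHits, List.elem_iff] at hk
    exact ⟨(hF n hn).1 hk, by simp⟩
  | succ k ih =>
    rw [firstHits, Bool.and_eq_true, Bool.and_eq_true] at hk
    obtain ⟨⟨-, hnF⟩, hk⟩ := hk
    replace hnF : n ∉ F := by simpa using hnF
    obtain ⟨h1, h2⟩ := ih (hF.nextLayer h hW) hk
    refine ⟨by rwa [show t + (k + 1) = t + 1 + k by omega], ?_⟩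
    intro j hj
    cases j with
    | zero => exact fun hr => hnF ((hF n hn).2 hr)
    | succ j =>
      rw [show t + (j + 1) = t + 1 + j by omega]
      exact h2 j (by omega)

/-- A successful run of `saturates` yields a set `R` of lengths that is closed under appending
a repetition. The invariant is that `S` collects the layers before layer `t` and that `F` is layer
`t`, so that one more repetition leads from `S` into `S` or `F`. -/
theorem exists_closed_of_saturates (h : IsToeplitz u g) (hW : Codes W g s L) {a k t : ℕ}
    (ha : a + 63 ≤ L) {S F : List ℕ} (hF : IsLayer g s L a t F)
    (hS : ∀ n ∈ S, n ≤ 52 ∧ ∃ t' < t, Reach g (s + a) t' n)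
    (hSF : ∀ m ∈ S, ∀ r, RepAt g (s + a + m) r → m + r ∈ S ∨ m + r ∈ F)
    (hk : saturates W a k S F = true) :
    ∃ R : List ℕ, (∀ n ∈ S, n ∈ R) ∧ (∀ n ∈ F, n ∈ R) ∧
      (∀ n ∈ R, n ≤ 52 ∧ ∃ t' < t + k, Reach g (s + a) t' n) ∧
      ∀ m ∈ R, ∀ r, RepAt g (s + a + m) r → m + r ∈ R := by
  induction k generalizing t S F with
  | zero =>
    have hFS : ∀ n ∈ F, n ∈ S := by simpa [saturates] using hk
    refine ⟨S, fun _ => id, hFS, fun n hn => (hS n hn).imp_right ?_,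
      fun m hm r hr => (hSF m hm r hr).elim id (hFS _)⟩
    exact fun ⟨t', h2, h3⟩ => ⟨t', by omega, h3⟩
  | succ k ih =>
    rw [saturates, Bool.or_eq_true, Bool.and_eq_true] at hk
    rcases hk with hk | ⟨hb, hk⟩
    · have hFS : ∀ n ∈ F, n ∈ S := by simpa using hk
      refine ⟨S, fun _ => id, hFS, fun n hn => (hS n hn).imp_right ?_,
        fun m hm r hr => (hSF m hm r hr).elim id (hFS _)⟩
      exact fun ⟨t', h2, h3⟩ => ⟨t', by omega, h3⟩
    · have hb' : ∀ n ∈ F, n ≤ 52 := by simpa using hb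
      have hS' : ∀ n ∈ F ++ S, n ≤ 52 ∧ ∃ t' < t + 1, Reach g (s + a) t' n := by
        intro n hn
        rcases List.mem_append.1 hn with hn | hn
        · have := hb' n hn
          exact ⟨this, t, by omega, (hF n (by omega)).1 hn⟩
        · obtain ⟨h1, t', h2, h3⟩ := hS n hn
          exact ⟨h1, t', by omega, h3⟩
      have hSF' : ∀ m ∈ F ++ S, ∀ r, RepAt g (s + a + m) r →
          m + r ∈ F ++ S ∨ m + r ∈ nextLayer W a F := by
        intro m hm r hr
        rcases List.mem_append.1 hm with hm | hm
        · right
          have := hb' m hm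
          obtain ⟨p, q, hp, hpq, hq, hpr, -⟩ := h.repAt_iff.1 hr
          rw [hF.nextLayer h hW _ (by omega)]
          exact ⟨m, r, (hF m (by omega)).1 hm, hr, rfl⟩
        · left
          exact List.mem_append.2 (hSF m hm r hr).symm
      obtain ⟨R, h1, -, h3, h4⟩ := ih (hF.nextLayer h hW) hS' hSF' hk
      refine ⟨R, fun n hn => h1 n (by simp [hn]), fun n hn => h1 n (by simp [hn]), ?_, h4⟩
      rwa [show t + (k + 1) = t + 1 + k by omega]

theorem exists_reach_lt_of_saturates (h : IsToeplitz u g) (hW : Codes W g s L) {a : ℕ}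
    (ha : a + 63 ≤ L) (hk : saturates W a 8 [] [0] = true) {t n : ℕ}
    (hr : Reach g (s + a) t n) : ∃ t' < 8, Reach g (s + a) t' n := by
  obtain ⟨R, -, h1, h2, h3⟩ := exists_closed_of_saturates h hW ha (isLayer_zero g s L a)
    (by simp) (by simp) hk
  have : n ∈ R := by
    induction t generalizing n with
    | zero => exact h1 n (by simpa [Reach] using hr)
    | succ t ih =>
      obtain ⟨m, r, hm, hr, rfl⟩ := hr
      exact h3 m (ih hm) r hr
  simpa using (h2 n this).2

/-! ### Windows and widths -/

/-- The window centred at `c = 2 ^ (K + 1) * (q + 1)` is a finite paperfolding word. Up to the level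
`K - 1` the signs do not see the shift by `2 ^ (K + 1) * q`; the level `K` only sees the parity of
`q`; the level `K + 1` is the letter at the centre. -/
theorem block_eq_finiteWord {u g : ℕ → ℤˣ} (h : IsToeplitz u g) (K q : ℕ) :
    block g (2 ^ (K + 1) * q + 1) (2 ^ (K + 2) - 1) =
      finiteWord (firstInstructions u K ++ [u K * (-1) ^ q, g (2 ^ (K + 1) * (q + 1))]) := by
  set v := firstInstructions u K ++ [u K * (-1) ^ q, g (2 ^ (K + 1) * (q + 1))] with hv
  have hvl : v.length = K + 2 := by simp [hv]
  have hlen := length_finiteWord v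
  rw [hvl] at hlen
  apply List.ext_getElem?
  intro d
  rw [getElem?_block]
  split_ifs with hd
  · obtain ⟨k, j, hkj⟩ := exists_eq_two_pow_mul (1 + d) (by omega)
    have hf := getElem?_finiteWord v k j (by rw [hvl]; omega)
    rw [← hkj, Nat.add_sub_cancel_left] at hf
    rw [hf, add_assoc, hkj, Option.some_inj]
    rcases lt_trichotomy k K with hk | rfl | hk
    · obtain ⟨c, rfl⟩ := Nat.exists_eq_add_of_lt hk
      rw [show 2 ^ (k + c + 1 + 1) * q + 2 ^ k * (2 * j + 1) =
          2 ^ k * (2 * (j + 2 * (2 ^ c * q)) + 1) by ring, h, hv,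
        List.getD_append _ _ _ _ (by simp), getD_firstInstructions _ (by omega),
        pow_add, pow_mul]
      simp
    · rw [show 2 ^ (k + 1) * q + 2 ^ k * (2 * j + 1) = 2 ^ k * (2 * (q + j) + 1) by ring, h, hv,
        List.getD_append_right _ _ _ _ (by simp), pow_add, ← mul_assoc]
      simp
    · obtain ⟨c, rfl⟩ := Nat.exists_eq_add_of_lt hk
      have hlt : 2 ^ (K + c + 1) * (2 * j + 1) < 2 ^ (K + 2) := by omega
      rw [show 2 ^ (K + c + 1) * (2 * j + 1) = 2 ^ (K + 1) * (2 ^ c * (2 * j + 1)) by ring,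
        pow_succ 2 (K + 1)] at hlt
      have hlt2 := lt_of_mul_lt_mul_left hlt (Nat.zero_le _)
      have hc : 0 < 2 ^ c := by positivity
      have hle : 2 * j + 1 ≤ 2 ^ c * (2 * j + 1) := Nat.le_mul_of_pos_left _ hc
      obtain rfl : j = 0 := by omega
      obtain rfl : c = 0 := by
        by_contra h0
        obtain ⟨c', rfl⟩ := Nat.exists_eq_succ_of_ne_zero h0
        rw [pow_succ] at hlt2
        omega
      rw [hv, List.getD_append_right _ _ _ _ (by simp)]
      simp [mul_add]
  · exact (List.getElem?_eq_none (by omega)).symm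

theorem codes_boolWord {u g : ℕ → ℤˣ} (h : IsToeplitz u g) {K q : ℕ} {l : List Bool}
    (hl : l.map sgn = firstInstructions u K ++ [u K * (-1) ^ q, g (2 ^ (K + 1) * (q + 1))]) :
    Codes (toCode (boolWord l)) g (2 ^ (K + 1) * q + 1) (2 ^ (K + 2) - 1) := by
  intro d hd
  have hw := congrArg (fun w => w[d]?) (block_eq_finiteWord h K q)
  simp only [← hl, ← map_sgn_boolWord, List.getElem?_map, getElem?_block, if_pos hd] at hw
  obtain ⟨b, hb, hg⟩ := Option.map_eq_some_iff.1 hw.symm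
  rw [testBit_toCode, List.getD_eq_getElem?_getD, hb, ← hg, Option.getD_some]

theorem sw_block_eq {g : ℕ → ℤˣ} {s n t : ℕ} (ht : t ≠ 0) (hr : Reach g s t n)
    (hlt : ∀ j < t, ¬ Reach g s j n) : sw (block g s n) = t := by
  apply le_antisymm
  · exact Nat.sInf_le (isRepetitionFactorization_block.2 ⟨ht, hr⟩)
  · refine le_csInf ⟨t, isRepetitionFactorization_block.2 ⟨ht, hr⟩⟩ fun j hj => ?_
    by_contra hjt
    exact hlt j (not_le.1 hjt) (isRepetitionFactorization_block.1 hj).2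

theorem sw_block_le_seven {u g : ℕ → ℤˣ} (h : IsToeplitz u g) (h01 : u 0 ≠ u 1)
    (h12 : u 1 = u 2) {i n : ℕ} (hx : HasRepetitionFactorization (block g (1 + i) n)) :
    sw (block g (1 + i) n) ≤ 7 := by
  obtain ⟨ws, hws⟩ := hx
  obtain ⟨h0, hr⟩ := isRepetitionFactorization_block.1 ⟨ws, hws, rfl⟩
  obtain ⟨a, ha⟩ := exists_sgn_eq (u 0)
  have hna : sgn (!a) = u 1 := by
    rw [sgn_not, ha]
    exact (Int.units_ne_iff_eq_neg.1 h01.symm).symm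
  obtain ⟨c, hc⟩ := exists_sgn_eq (u 3)
  obtain ⟨d, hd⟩ := exists_sgn_eq (u 4)
  obtain ⟨e, he⟩ := exists_sgn_eq (u 5 * (-1) ^ (i / 64))
  obtain ⟨f, hf⟩ := exists_sgn_eq (g (2 ^ 6 * (i / 64 + 1)))
  have hcodes := codes_boolWord h (K := 5) (q := i / 64) (l := [a, !a, !a, c, d, e, f])
    (by simp [firstInstructions, List.range_succ, ha, hna, hc, hd, he, hf, ← h12])
  have hsat := List.all_eq_true.1 (saturates_boolWord a c d e f) (i % 64)
    (List.mem_range.2 (Nat.mod_lt _ (by norm_num)))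
  -- The block starts at position `i % 64` of the window centred at `64 * (i / 64 + 1)`.
  have hi : 1 + i = 2 ^ (5 + 1) * (i / 64) + 1 + i % 64 := by omega
  rw [hi] at hr ⊢
  obtain ⟨t, ht, hrt⟩ := exists_reach_lt_of_saturates h hcodes (by norm_num; omega) hsat hr
  have hn : n ≠ 0 := by
    rintro rfl
    obtain ⟨t', ht'⟩ := Nat.exists_eq_succ_of_ne_zero h0
    rw [ht'] at hr
    obtain ⟨m, r, -, ⟨p, hp⟩, hmr⟩ := hr
    omega
  have ht0 : t ≠ 0 := by
    rintro rfl
    exact hn hrt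
  exact (Nat.sInf_le (isRepetitionFactorization_block.2 ⟨ht0, hrt⟩)).trans (by omega)

theorem exists_sw_block_eq_ten {u g : ℕ → ℤˣ} (h : IsToeplitz u g)
    (hu : u 0 = u 1 ∨ u 1 ≠ u 2) :
    ∃ i n, i + n ≤ 255 ∧ sw (block g (1 + i) n) = 10 := by
  obtain ⟨a, ha⟩ := exists_sgn_eq (u 0)
  obtain ⟨b, hb⟩ := exists_sgn_eq (u 1)
  obtain ⟨c, hc⟩ := exists_sgn_eq (u 2)
  obtain ⟨d, hd⟩ := exists_sgn_eq (u 3)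
  obtain ⟨e, he⟩ := exists_sgn_eq (u 4)
  rw [← ha, ← hb, ← hc, sgn_injective.eq_iff, sgn_injective.ne_iff] at hu
  obtain ⟨f, hf⟩ := firstHits_boolWord a b c d e hu
  -- The sixth instructions of the windows centred at `64` and at `128` are `u 5` and `-u 5`.
  obtain ⟨q, hq, hfq⟩ : ∃ q ≤ 1, sgn f = u 5 * (-1) ^ q := by
    rcases eq_or_ne (sgn f) (u 5) with h5 | h5
    · exact ⟨0, by omega, by simpa using h5⟩
    · exact ⟨1, le_rfl, by simpa using Int.units_ne_iff_eq_neg.1 h5⟩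
  obtain ⟨k, hk⟩ := exists_sgn_eq (g (2 ^ 6 * (q + 1)))
  have hcodes := codes_boolWord h (K := 5) (q := q) (l := [a, b, c, d, e, f, k])
    (by simp [firstInstructions, List.range_succ, ha, hb, hc, hd, he, hfq, hk])
  obtain ⟨i, hi, hany⟩ := List.any_eq_true.1 (hf k)
  obtain ⟨n, hn, hhit⟩ := List.any_eq_true.1 hany
  have hi' : i ≤ 63 := by
    simp only [List.mem_cons, List.not_mem_nil, or_false] at hi
    omega
  have hn' : n ≤ 41 := by
    simp only [List.mem_cons, List.not_mem_nil, or_false] at hn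
    omega
  obtain ⟨h1, h2⟩ := reach_of_firstHits h hcodes (by norm_num; omega)
    (isLayer_zero g _ _ i) hhit
  simp only [zero_add] at h1 h2
  refine ⟨2 ^ 6 * q + i, n, by omega, ?_⟩
  rw [show 1 + (2 ^ 6 * q + i) = 2 ^ (5 + 1) * q + 1 + i by omega]
  exact sw_block_eq (by norm_num) h1 h2

/-- The dichotomy for a set `P` of factors of a paperfolding sequence that contains all factors of
its prefix of length `255`. -/
theorem xor_of_factors {u g : ℕ → ℤˣ} (h : IsToeplitz u g) {P : List ℤˣ → Prop}
    (hP : ∀ x, P x → ∃ i n, x = block g (1 + i) n)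
    (hP' : ∀ i n, i + n ≤ 255 → P (block g (1 + i) n)) :
    Xor (∀ x, P x → HasRepetitionFactorization x → sw x ≤ 7) (∃ x, P x ∧ sw x = 10) := by
  by_cases hu : u 0 = u 1 ∨ u 1 ≠ u 2
  · obtain ⟨i, n, hin, hx⟩ := exists_sw_block_eq_ten h hu
    refine Or.inr ⟨⟨_, hP' i n hin, hx⟩, fun hle => ?_⟩
    have := hle _ (hP' i n hin) (hasRepetitionFactorization_of_sw_ne_zero (by omega))
    omega
  · rw [not_or, not_not] at hu
    have hle : ∀ x, P x → HasRepetitionFactorization x → sw x ≤ 7 := by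
      intro x hx hrep
      obtain ⟨i, n, rfl⟩ := hP x hx
      exact sw_block_le_seven h hu.1 hu.2 hrep
    refine Or.inl ⟨hle, ?_⟩
    rintro ⟨x, hx, hx10⟩
    have := hle x hx (hasRepetitionFactorization_of_sw_ne_zero (by omega))
    omega

end Paperfolding

theorem theorem13 :
    (∀ u : List ℤˣ, 8 ≤ u.length →
      Xor
        (∀ x : List ℤˣ, x <:+: Paperfolding.finiteWord u →
          Paperfolding.HasRepetitionFactorization x → Paperfolding.sw x ≤ 7)
        (∃ x : List ℤˣ, x <:+: Paperfolding.finiteWord u ∧ Paperfolding.sw x = 10)) ∧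
    (∀ u : ℕ → ℤˣ,
      Xor
        (∀ x : List ℤˣ, Paperfolding.IsFactorOfSeq x (Paperfolding.infiniteWord u) →
          Paperfolding.HasRepetitionFactorization x → Paperfolding.sw x ≤ 7)
        (∃ x : List ℤˣ, Paperfolding.IsFactorOfSeq x (Paperfolding.infiniteWord u) ∧
          Paperfolding.sw x = 10)) := by
  refine ⟨fun u hu => ?_, fun u => ?_⟩
  · have h := Paperfolding.isToeplitz_letter fun k => u.getD k 1
    have hw := Paperfolding.finiteWord_firstInstructions h u.length
    rw [Paperfolding.firstInstructions_getD] at hw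
    have h8 : 2 ^ 8 ≤ 2 ^ u.length := Nat.pow_le_pow_right (by norm_num) hu
    refine Paperfolding.xor_of_factors h (fun x hx => ?_) fun i n hin => ?_
    · rw [hw, Paperfolding.isInfix_block] at hx
      obtain ⟨i, n, -, rfl⟩ := hx
      exact ⟨i, n, rfl⟩
    · rw [hw, Paperfolding.isInfix_block]
      exact ⟨i, n, by omega, rfl⟩
  · exact Paperfolding.xor_of_factors (Paperfolding.isToeplitz_letter u)
      (fun x hx => Paperfolding.isFactorOfSeq_infiniteWord.1 hx)
      fun i n _ => Paperfolding.isFactorOfSeq_infiniteWord.2 ⟨i, n, rfl⟩
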